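/- Let $I,J\subset\mathbb R$ be intervals (possibly empty, degenerate or unbounded), $E$ a real Banach space, and $F=\operatorname{End}(E)$ the Banach space of continuous linear maps $E\to E$ with the operator norm. Here $L^1(J;F)$ is the set of Bochner integrable functions $J\to F$, with $\|y\|_{L^1(J;F)}=\int_J\|y\|\,d\lambda$, and the subscript "loc" means that the property in question holds on every compact subinterval; functions that agree almost everywhere are not identified. Let $$G\colon I\to L^\infty_{loc}(J;F)\cap L^1(J;F)$$ be continuous with respect to the supremum distance $d_\infty(x,y)=\sup_{u\in J}\|x(u)-y(u)\|\in[0,\infty]$ on $F^J$, and of bounded variation with respect to $L^1(J;F)$, that is, $$V:=\sup\Big\{\sum_{i<n}\|G(a_{i+1})-G(a_i)\|_{L^1(J;F)} \;\Big|\; n\in\mathbb N,\ a_0<a_1<\dots<a_n \text{ in } I\Big\}<\infty .$$ Put $N:=\exp\big(\sup_{t\in I}\|G(t)\|_{L^1(J;F)}\big)$, the supremum being taken in $[0,\infty]$ (it is finite). Then, for every locally absolutely continuous $f\colon I\to\mathbb R$ with $f(I)\subset J$, the function $$A\colon I\to F,\qquad A(t)=f'(t)\cdot G(t)(f(t)),$$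 where $f'(t)$ is the derivative of $f$ at $t$ if $f$ is differentiable at $t$ and $0$ otherwise, satisfies: 1. $A\in L^1_{loc}(I;F)$; 2. if $X$ is an evolution operator for $A$ in $E$, then for all $s,t\in I$ with $s\le t$ the operator $X(t,s)$ is invertible and $$\|X(t,s)^{\pm1}\|\le N^2\exp\big(N^{3+2N}\,V\big).$$ In particular, the bound does not depend on $f$. Here an evolution operator for $A$ in $E$ is a function $X\colon I\times I\to F$ such that, for all $s\in I$, $X(s,s)=\mathrm{id}_E$, the function $X(\cdot,s)$ is continuous on $I$, $\tau\mapsto A(\tau)\circ X(\tau,s)$ lies in $L^1_{loc}(I;F)$, and $X(t,s)-X(r,s)=\int_r^t A(\tau)\circ X(\tau,s)\,d\lambda(\tau)$ for all $r,t\in I$. -/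

import Mathlib

open MeasureTheory Set Filter Topology
open scoped ENNReal

/-- `y ∈ L^∞_loc(J; F)`: on every compact interval contained in `J`, the function `y` is
Bochner measurable and essentially bounded. -/
def MemLInftyLoc {F : Type*} [NormedAddCommGroup F] (J : Set ℝ) (y : ℝ → F) : Prop :=
  ∀ a b : ℝ, Icc a b ⊆ J → MemLp y ∞ (volume.restrict (Icc a b))

/-- `x ∈ L^1_loc(I; F)`: on every compact interval contained in `I`, the function `x` is
Bochner integrable. -/
def MemL1Loc {F : Type*} [NormedAddCommGroup F] (I : Set ℝ) (x : ℝ → F) : Prop :=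
  ∀ a b : ℝ, Icc a b ⊆ I → IntegrableOn x (Icc a b) volume

/-- `f ∈ AC_loc(I)`: `f` is absolutely continuous on every compact interval contained in `I`. -/
def LocallyAbsolutelyContinuousOn (f : ℝ → ℝ) (I : Set ℝ) : Prop :=
  ∀ a b : ℝ, a ≤ b → Icc a b ⊆ I → AbsolutelyContinuousOnInterval f a b

/-- The norm of `L^1(J; F)`, as an element of `[0, ∞]`. -/
noncomputable def l1Norm {F : Type*} [NormedAddCommGroup F] (J : Set ℝ) (y : ℝ → F) : ℝ≥0∞ :=
  ∫⁻ u in J, ‖y u‖ₑ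

/-- The supremum distance of the restrictions to `J` of two functions, an element of `[0, ∞]`. -/
noncomputable def supDist {F : Type*} [NormedAddCommGroup F] (J : Set ℝ) (x y : ℝ → F) : ℝ≥0∞ :=
  ⨆ u ∈ J, edist (x u) (y u)

/-- Continuity on `I` of the family of functions `G t : J → F` for the supremum distance. -/
def SupDistContinuousOn {F : Type*} [NormedAddCommGroup F] (G : ℝ → ℝ → F) (I J : Set ℝ) : Prop :=
  ∀ t ∈ I, Tendsto (fun s => supDist J (G s) (G t)) (𝓝[I] t) (𝓝 0)

/-- The total variation on `I` of `t ↦ G t` with respect to the norm of `L^1(J; F)`: the supremum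
in `[0, ∞]` of `∑_{i < n} ‖G (a (i + 1)) - G (a i)‖` over all finite strictly increasing
sequences `a 0 < ⋯ < a n` of elements of `I`. -/
noncomputable def l1Variation {F : Type*} [NormedAddCommGroup F] (G : ℝ → ℝ → F) (I J : Set ℝ) :
    ℝ≥0∞ :=
  ⨆ (n : ℕ) (a : Fin (n + 1) → ℝ) (_ : StrictMono a) (_ : ∀ i, a i ∈ I),
    ∑ i : Fin n, l1Norm J (fun u => G (a i.succ) u - G (a i.castSucc) u)

/-- `Y : I → End E` is an operator solution on `I` for `A : I → End E`: it is continuous, the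
product `A Y` is locally integrable, and `Y t - Y s = ∫_s^t A Y` for all `s, t ∈ I`. -/
structure IsOperatorSolution {E : Type*} [NormedAddCommGroup E] [NormedSpace ℝ E]
    (I : Set ℝ) (A Y : ℝ → E →L[ℝ] E) : Prop where
  continuousOn : ContinuousOn Y I
  memL1Loc : MemL1Loc I (fun τ => (A τ).comp (Y τ))
  sub_eq_integral : ∀ s ∈ I, ∀ t ∈ I, Y t - Y s = ∫ τ in s..t, (A τ).comp (Y τ)

/-- `X : I × I → End E` is an evolution operator for `A : I → End E`. -/
structure IsEvolutionOperator {E : Type*} [NormedAddCommGroup E] [NormedSpace ℝ E]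
    (I : Set ℝ) (A : ℝ → E →L[ℝ] E) (X : ℝ → ℝ → E →L[ℝ] E) : Prop where
  isOperatorSolution : ∀ s ∈ I, IsOperatorSolution I A (fun t => X t s)
  apply_self : ∀ s ∈ I, X s s = ContinuousLinearMap.id ℝ E

/-!
For a coefficient `g` that does not depend on time, the equation `x' = f' g(f) x` is solved by
`x = Y ∘ f`, where `Y' = g Y` on `J`: the solution depends on `f` only through its values, and `Y`
and its inverse `W` are bounded by the exponential of the `L¹` norm of `g`, hence by `N`
(`exists_isFundamentalPair`). Freezing the time in `G` gives such a pair `Y r`, `W r` for every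
`r ∈ I`, and the proof follows `z r = ‖W r (f r) * x r‖` for a solution `x` of `x' = A x`. While `r`
is kept fixed, `W r (f ·) * x` has the derivative `W r (f ·) * (A - f' • G r (f ·)) * x`, which is at
most a constant times `ε |f'|` as long as `G` stays within sup distance `ε` of `G r`. Exchanging
`W r` for `W q` costs a factor `‖W q * Y r‖ ≤ 1 + N² ‖G q - G r‖`, with the `L¹` norm, by
`norm_mul_sub_one_le`. Both steps are combined in `norm_mul_le_of_step`. Over a fine partition the
factors multiply to at most `exp (N² V)` and the other terms are `O(ε)`, so that
`‖x t‖ ≤ N² exp (N² V) ‖x s‖`, and the same with `s` and `t` exchanged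
(`IsOperatorSolution.norm_le_and_norm_le`). As `N ≥ 1`, this is stronger than the bound claimed. It
also shows that a solution vanishing at one time vanishes at all times, whence `X s t` is the
inverse of `X t s`.

Two facts of real analysis make this rigorous for coefficients defined only up to null sets. At
almost every point of the preimage of a null set under `f`, the derivative of `f` vanishes
(`ae_deriv_eq_zero_of_mem_null`); this gives the measurability of `A` and the chain rule for
`W ∘ f`. And an absolutely continuous function with values in a Banach space is controlled by a bound
on its derivative almost everywhere (`AbsolutelyContinuousOnInterval.norm_sub_le_integral`).
-/

/-! ### Absolutely continuous functions -/

namespace AbsolutelyContinuousOnInterval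

/-- A function whose increments are dominated by those of absolutely continuous functions is
absolutely continuous. -/
theorem of_dist_le {X Y Z : Type*} [PseudoMetricSpace X] [PseudoMetricSpace Y]
    [PseudoMetricSpace Z] {f : ℝ → X} {g : ℝ → Y} {h : ℝ → Z} {a b C D : ℝ}
    (hg : AbsolutelyContinuousOnInterval g a b) (hh : AbsolutelyContinuousOnInterval h a b)
    (H : ∀ x ∈ uIcc a b, ∀ y ∈ uIcc a b,
      dist (f x) (f y) ≤ C * dist (g x) (g y) + D * dist (h x) (h y)) :
    AbsolutelyContinuousOnInterval f a b := by
  unfold AbsolutelyContinuousOnInterval at hg hh ⊢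
  refine squeeze_zero' (Eventually.of_forall fun E => Finset.sum_nonneg fun _ _ => dist_nonneg) ?_
    (by simpa using (hg.const_mul C).add (hh.const_mul D))
  rw [eventually_inf_principal]
  refine Eventually.of_forall fun E hE => ?_
  rw [Finset.mul_sum, Finset.mul_sum, ← Finset.sum_add_distrib]
  exact Finset.sum_le_sum fun i hi => H _ (hE.1 i hi).1 _ (hE.1 i hi).2

theorem of_dist_le_mul {X Y : Type*} [PseudoMetricSpace X] [PseudoMetricSpace Y]
    {f : ℝ → X} {g : ℝ → Y} {a b C : ℝ} (hg : AbsolutelyContinuousOnInterval g a b)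
    (H : ∀ x ∈ uIcc a b, ∀ y ∈ uIcc a b, dist (f x) (f y) ≤ C * dist (g x) (g y)) :
    AbsolutelyContinuousOnInterval f a b :=
  of_dist_le (D := 0) hg hg fun x hx y hy => by simpa using H x hx y hy

theorem continuousLinearMap_comp {F F' : Type*} [NormedAddCommGroup F] [NormedSpace ℝ F]
    [NormedAddCommGroup F'] [NormedSpace ℝ F'] (φ : F →L[ℝ] F') {H : ℝ → F} {a b : ℝ}
    (hH : AbsolutelyContinuousOnInterval H a b) :
    AbsolutelyContinuousOnInterval (fun x => φ (H x)) a b :=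
  hH.of_dist_le_mul (C := ‖φ‖) fun x _ y _ => φ.dist_le_opNorm (H x) (H y)

theorem lipschitzOn_comp {X Y : Type*} [PseudoMetricSpace X] [PseudoMetricSpace Y]
    {W : X → Y} {f : ℝ → X} {S : Set X} {K : NNReal} {a b : ℝ} (hW : LipschitzOnWith K W S)
    (hf : AbsolutelyContinuousOnInterval f a b) (hfS : MapsTo f (uIcc a b) S) :
    AbsolutelyContinuousOnInterval (fun x => W (f x)) a b :=
  hf.of_dist_le_mul (C := K) fun _ hx _ hy => hW.dist_le_mul _ (hfS hx) _ (hfS hy)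

theorem ring_mul {R : Type*} [NormedRing R] {f g : ℝ → R} {a b : ℝ}
    (hf : AbsolutelyContinuousOnInterval f a b) (hg : AbsolutelyContinuousOnInterval g a b) :
    AbsolutelyContinuousOnInterval (fun x => f x * g x) a b := by
  obtain ⟨C, hC⟩ := hf.exists_bound
  obtain ⟨D, hD⟩ := hg.exists_bound
  refine of_dist_le (C := D) (D := C) hf hg fun x hx y hy => ?_
  simp only [dist_eq_norm]
  calc ‖f x * g x - f y * g y‖ = ‖(f x - f y) * g x + f y * (g x - g y)‖ := by
        congr 1; noncomm_ring
    _ ≤ ‖f x - f y‖ * ‖g x‖ + ‖f y‖ * ‖g x - g y‖ :=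
        (norm_add_le _ _).trans (add_le_add (norm_mul_le _ _) (norm_mul_le _ _))
    _ ≤ D * ‖f x - f y‖ + C * ‖g x - g y‖ := by
        rw [mul_comm D]
        gcongr
        · exact hD x hx
        · exact hC y hy

theorem primitive {F : Type*} [NormedAddCommGroup F] [NormedSpace ℝ F]
    {k : ℝ → F} {a b c : ℝ} (hk : IntervalIntegrable k volume a b) (hc : c ∈ uIcc a b) :
    AbsolutelyContinuousOnInterval (fun x => ∫ v in c..x, k v) a b := by
  refine (hk.norm.absolutelyContinuousOnInterval_intervalIntegral hc).of_dist_le_mul (C := 1)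
    fun x hx y hy => ?_
  have hcx : IntervalIntegrable k volume c x := hk.mono_set (uIcc_subset_uIcc hc hx)
  have hcy : IntervalIntegrable k volume c y := hk.mono_set (uIcc_subset_uIcc hc hy)
  rw [one_mul, dist_eq_norm, Real.dist_eq, intervalIntegral.integral_interval_sub_left hcx hcy,
    intervalIntegral.integral_interval_sub_left hcx.norm hcy.norm]
  exact intervalIntegral.norm_integral_le_abs_integral_norm

/-- Mean value inequality. No measurability of the derivative is needed and the target space may
fail the Radon-Nikodym property: testing against a norming functional reduces the claim to the
fundamental theorem of calculus for real valued functions. -/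
theorem norm_sub_le_integral {F : Type*} [NormedAddCommGroup F] [NormedSpace ℝ F] {H : ℝ → F}
    {k : ℝ → ℝ} {a b : ℝ} (hH : AbsolutelyContinuousOnInterval H a b)
    (hk : IntervalIntegrable k volume a b)
    (hd : ∀ᵐ x, x ∈ uIcc a b → ∃ h' : F, HasDerivAt H h' x ∧ ‖h'‖ ≤ k x) :
    ‖H b - H a‖ ≤ ∫ x in uIoc a b, k x := by
  obtain ⟨φ, hφ1, hφ⟩ := exists_dual_vector'' ℝ (H b - H a)
  have hφH := hH.continuousLinearMap_comp φ
  have h1 := hφH.integral_deriv_eq_sub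
  rw [← map_sub, hφ] at h1
  have h2 : ‖H b - H a‖ = ‖∫ x in a..b, deriv (fun x => φ (H x)) x‖ := by
    rw [h1]; simp
  rw [h2, intervalIntegral.norm_intervalIntegral_eq]
  refine norm_integral_le_of_norm_le hk.def' ?_
  filter_upwards [ae_restrict_of_ae hd, ae_restrict_mem measurableSet_uIoc] with x hx hxm
  obtain ⟨h', hd', hle⟩ := hx (uIoc_subset_uIcc hxm)
  have hφd : HasDerivAt (fun x => φ (H x)) (φ h') x := φ.hasFDerivAt.comp_hasDerivAt x hd'
  rw [hφd.deriv]
  exact ((φ.le_opNorm h').trans (mul_le_of_le_one_left (norm_nonneg _) hφ1)).trans hle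

end AbsolutelyContinuousOnInterval

/-- A function is stationary at almost every point of the preimage of a null set at which it is
differentiable. Near a point where the derivative is nonzero, `f` expands distances to that point;
the set of points where this happens with given constants is locally a Lipschitz image of its own
image under `f`. -/
theorem ae_deriv_eq_zero_of_mem_null {f : ℝ → ℝ} {Z : Set ℝ} (hZ : volume Z = 0) :
    ∀ᵐ x, f x ∈ Z → ∀ f', HasDerivAt f f' x → f' = 0 := by
  let S : ℕ → Set ℝ := fun n =>
    {x | f x ∈ Z ∧ ∀ y, |y - x| < 1 / (n + 1) → |y - x| ≤ (n + 1) * |f y - f x|}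
  -- `f` restricted to a short piece `T` of `S n` has a Lipschitz inverse, and `f '' T` is null
  have hS : ∀ n, volume (S n) = 0 := by
    intro n
    refine measure_null_of_locally_null _ fun x hx => ?_
    have hn : (0 : ℝ) < 1 / (n + 1) := by positivity
    set T : Set ℝ := S n ∩ Metric.ball x (1 / (n + 1) / 2) with hT
    refine ⟨T, inter_mem_nhdsWithin _ (Metric.ball_mem_nhds x (half_pos hn)), ?_⟩
    have hexp : ∀ y ∈ T, ∀ z ∈ T, |y - z| ≤ (n + 1) * |f y - f z| := by
      intro y hy z hz
      refine hz.1.2 y ?_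
      have h1 := hy.2
      have h2 := hz.2
      rw [Metric.mem_ball, Real.dist_eq] at h1 h2
      have := abs_sub_le y x z
      rw [abs_sub_comm x z] at this
      linarith
    have hinj : InjOn f T := fun y hy z hz hyz => by
      have := hexp y hy z hz
      rw [hyz, sub_self, abs_zero, mul_zero] at this
      exact sub_eq_zero.1 (abs_nonpos_iff.1 this)
    have hlip : LipschitzOnWith (n + 1 : NNReal) (Function.invFunOn f T) (f '' T) := by
      refine LipschitzOnWith.of_dist_le_mul ?_
      rintro _ ⟨y, hy, rfl⟩ _ ⟨z, hz, rfl⟩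
      rw [hinj.leftInvOn_invFunOn hy, hinj.leftInvOn_invFunOn hz, Real.dist_eq, Real.dist_eq]
      simpa using hexp y hy z hz
    have h0 : volume (f '' T) = 0 :=
      measure_mono_null (by rintro _ ⟨y, hy, rfl⟩; exact hy.1.1) hZ
    have := hlip.hausdorffMeasure_image_le (d := 1) zero_le_one
    rw [hausdorffMeasure_real, h0, mul_zero,
      hinj.leftInvOn_invFunOn.image_image] at this
    exact le_antisymm this (zero_le)
  have hall : ∀ᵐ x, ∀ n, x ∉ S n := ae_all_iff.2 fun n => measure_eq_zero_iff_ae_notMem.1 (hS n)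
  filter_upwards [hall] with x hx hxZ f' hf'
  by_contra hne
  have hpos : 0 < ‖f'‖ := norm_pos_iff.2 hne
  have hev : ∀ᶠ y in 𝓝 x, |y - x| ≤ (2 / ‖f'‖) * |f y - f x| := by
    have := (hasDerivAt_iff_isLittleO.1 hf').def (half_pos hpos)
    filter_upwards [this] with y hy
    have h1 : ‖f'‖ * |y - x| = ‖(y - x) • f'‖ := by
      rw [norm_smul, mul_comm, Real.norm_eq_abs (y - x)]
    have h2 : ‖(y - x) • f'‖ ≤ ‖f y - f x‖ + ‖f y - f x - (y - x) • f'‖ := by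
      have := norm_sub_le (f y - f x) (f y - f x - (y - x) • f')
      rwa [sub_sub_cancel] at this
    rw [Real.norm_eq_abs (y - x)] at hy
    rw [Real.norm_eq_abs (f y - f x)] at h2
    rw [div_mul_eq_mul_div, le_div_iff₀ hpos]
    nlinarith
  obtain ⟨δ, hδ, hball⟩ := Metric.eventually_nhds_iff.1 hev
  obtain ⟨n₁, hn₁⟩ := exists_nat_one_div_lt hδ
  obtain ⟨n₂, hn₂⟩ := exists_nat_ge (2 / ‖f'‖)
  refine hx (max n₁ n₂) ⟨hxZ, fun y hy => ?_⟩
  refine (hball (y := y) ?_).trans ?_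
  · rw [Real.dist_eq]
    refine hy.trans (lt_of_le_of_lt ?_ hn₁)
    gcongr
    exact le_max_left _ _
  · gcongr
    refine hn₂.trans ?_
    have : (n₂ : ℝ) ≤ (max n₁ n₂ : ℕ) := by exact_mod_cast le_max_right _ _
    linarith

/-- Chain rule for the composition of a Lipschitz function with an absolutely continuous one. The
points where the outer derivative is unavailable are harmless, since there `f` is stationary. -/
theorem ae_hasDerivAt_lipschitz_comp {F : Type*} [NormedAddCommGroup F] [NormedSpace ℝ F]
    {W w : ℝ → F} {f : ℝ → ℝ} {K : NNReal} {a b c d : ℝ} (hW : LipschitzOnWith K W (Icc c d))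
    (hd : ∀ᵐ u, u ∈ Icc c d → HasDerivAt W (w u) u)
    (hf : AbsolutelyContinuousOnInterval f a b) (hfK : MapsTo f (uIcc a b) (Icc c d)) :
    ∀ᵐ x, x ∈ uIcc a b → HasDerivAt (fun x => W (f x)) (deriv f x • w (f x)) x := by
  have ha : ∀ᵐ x : ℝ, x ≠ a := by simp [ae_iff, measure_singleton]
  have hb : ∀ᵐ x : ℝ, x ≠ b := by simp [ae_iff, measure_singleton]
  have hnull := ae_deriv_eq_zero_of_mem_null (f := f) (ae_iff.1 hd)
  filter_upwards [ha, hb, hnull, hf.ae_differentiableAt] with x hxa hxb hx hfd hxm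
  have hf' := (hfd hxm).hasDerivAt
  by_cases hgood : f x ∈ Icc c d → HasDerivAt W (w (f x)) (f x)
  · exact (hgood (hfK hxm)).scomp x hf'
  · have h0 : deriv f x = 0 := hx hgood _ hf'
    rw [h0, zero_smul]
    rw [h0] at hf'
    have hnhds : uIcc a b ∈ 𝓝 x := by
      rcases le_total a b with h | h
      · rw [uIcc_of_le h] at hxm ⊢
        exact Icc_mem_nhds (lt_of_le_of_ne hxm.1 hxa.symm) (lt_of_le_of_ne hxm.2 hxb)
      · rw [uIcc_of_ge h] at hxm ⊢
        exact Icc_mem_nhds (lt_of_le_of_ne hxm.1 hxb.symm) (lt_of_le_of_ne hxm.2 hxa)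
    rw [hasDerivAt_iff_isLittleO] at hf' ⊢
    simp only [smul_zero, sub_zero] at hf' ⊢
    refine Asymptotics.IsBigO.trans_isLittleO ?_ hf'
    refine Asymptotics.IsBigO.of_bound K ?_
    filter_upwards [hnhds] with y hy
    simpa [dist_eq_norm] using hW.dist_le_mul _ (hfK hy) _ (hfK hxm)

/-! ### Linear equations with integrable coefficient -/

section LinearEquation

variable {F : Type*} [NormedAddCommGroup F] [NormedSpace ℝ F]

/-- The substitution rule for powers of the absolutely continuous `v ↦ ∫ w in c..v, k w`. -/
theorem integral_mul_primitive_pow {k : ℝ → ℝ} (hk : Integrable k) (c u : ℝ) (n : ℕ) :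
    ∫ v in c..u, k v * (∫ w in c..v, k w) ^ n = (∫ w in c..u, k w) ^ (n + 1) / (n + 1) := by
  have hac : AbsolutelyContinuousOnInterval (fun v => ∫ w in c..v, k w) c u :=
    hk.intervalIntegrable.absolutelyContinuousOnInterval_intervalIntegral left_mem_uIcc
  have hpow : ∀ m : ℕ,
      AbsolutelyContinuousOnInterval (fun v => (∫ w in c..v, k w) ^ (m + 1)) c u := by
    intro m
    induction m with
    | zero => simpa using hac
    | succ m ih => simpa only [pow_succ _ (m + 1)] using ih.fun_mul hac
  have h := (hpow n).integral_deriv_eq_sub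
  have hd := LocallyIntegrable.ae_hasDerivAt_integral hk.locallyIntegrable
  have h' : ∫ v in c..u, deriv (fun v => (∫ w in c..v, k w) ^ (n + 1)) v =
      ∫ v in c..u, (n + 1) * (k v * (∫ w in c..v, k w) ^ n) := by
    refine intervalIntegral.integral_congr_ae ?_
    filter_upwards [hd] with v hv _
    rw [((hv c).fun_pow (n + 1)).deriv]
    push_cast
    ring_nf
  rw [h', intervalIntegral.integral_const_mul, intervalIntegral.integral_same,
    zero_pow (Nat.succ_ne_zero n), sub_zero] at h
  rw [← h]
  field_simp

/-- The terms of the Neumann series of the Volterra equation `y u = y₀ + ∫ v in c..u, B v (y v)`: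
iterated integrals of the coefficient `B`. -/
noncomputable def volterraTerm (B : ℝ → F →L[ℝ] F) (y₀ : F) (c : ℝ) : ℕ → ℝ → F
  | 0 => fun _ => y₀
  | n + 1 => fun u => ∫ v in c..u, B v (volterraTerm B y₀ c n v)

variable {B : ℝ → F →L[ℝ] F}

theorem integrableOn_clm_apply {S : Set ℝ} {y : ℝ → F} {M : ℝ} (hB : IntegrableOn B S)
    (hS : MeasurableSet S) (hy : AEStronglyMeasurable y (volume.restrict S))
    (hM : ∀ u ∈ S, ‖y u‖ ≤ M) : IntegrableOn (fun u => B u (y u)) S := by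
  refine Integrable.mono' (hB.norm.mul_const M) ?_ ?_
  · exact (ContinuousLinearMap.apply ℝ F : F →L[ℝ] (F →L[ℝ] F) →L[ℝ] F).aestronglyMeasurable_comp₂
      hy hB.aestronglyMeasurable
  · filter_upwards [ae_restrict_mem hS] with u hu
    exact (B u).le_of_opNorm_le_of_le le_rfl (hM u hu)

theorem intervalIntegrable_clm_apply (hB : Integrable B) {y : ℝ → F} (hy : Continuous y)
    (a b : ℝ) : IntervalIntegrable (fun v => B v (y v)) volume a b := by
  obtain ⟨M, hM⟩ := isCompact_uIcc.exists_bound_of_continuousOn (hy.continuousOn (s := uIcc a b))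
  rw [intervalIntegrable_iff]
  exact integrableOn_clm_apply hB.integrableOn measurableSet_uIoc
    hy.aestronglyMeasurable (fun u hu => hM u (uIoc_subset_uIcc hu))

theorem continuous_volterraTerm (hB : Integrable B) (y₀ : F) (c : ℝ) (n : ℕ) :
    Continuous (volterraTerm B y₀ c n) := by
  induction n with
  | zero => exact continuous_const
  | succ n ih => exact intervalIntegral.continuous_primitive (intervalIntegrable_clm_apply hB ih) c

/-- The estimate by `m ^ n / n!`, with `m` the integral of `‖B‖`, gives the sharp exponential bound
for the sum of the series. -/
theorem norm_volterraTerm_le (hB : Integrable B) (y₀ : F) {c u : ℝ} (hu : c ≤ u) (n : ℕ) :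
    ‖volterraTerm B y₀ c n u‖ ≤ ‖y₀‖ * ((∫ v in c..u, ‖B v‖) ^ n / n.factorial) := by
  induction n generalizing u with
  | zero => simp [volterraTerm]
  | succ n ih =>
    have hpc : Continuous fun u => ∫ v in c..u, ‖B v‖ :=
      intervalIntegral.continuous_primitive (fun a b => hB.norm.intervalIntegrable) c
    have hint : IntervalIntegrable
        (fun v => (‖y₀‖ / n.factorial) * (‖B v‖ * (∫ w in c..v, ‖B w‖) ^ n)) volume c u :=
      (hB.norm.intervalIntegrable.mul_continuousOn (hpc.pow n).continuousOn).const_mul _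
    calc ‖volterraTerm B y₀ c (n + 1) u‖
        ≤ ∫ v in c..u, (‖y₀‖ / n.factorial) * (‖B v‖ * (∫ w in c..v, ‖B w‖) ^ n) := by
          refine intervalIntegral.norm_integral_le_of_norm_le hu ?_ hint
          refine Eventually.of_forall fun v hv => ?_
          refine ((B v).le_of_opNorm_le_of_le le_rfl (ih hv.1.le)).trans (le_of_eq ?_)
          ring
      _ = _ := by
          rw [intervalIntegral.integral_const_mul, integral_mul_primitive_pow hB.norm,
            Nat.factorial_succ]
          push_cast
          field_simp

/-- Linear Carathéodory equations `y' = B y` with integrable coefficient have solutions, with the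
exponential bound. -/
theorem exists_linear_integral_equation [CompleteSpace F] (hB : Integrable B) (y₀ : F) (c : ℝ) :
    ∃ y : ℝ → F, ContinuousOn y (Ici c) ∧
      (∀ u, c ≤ u → ‖y u‖ ≤ ‖y₀‖ * Real.exp (∫ v in c..u, ‖B v‖)) ∧
      ∀ u, c ≤ u → y u = y₀ + ∫ v in c..u, B v (y v) := by
  have hmono : ∀ {u}, c ≤ u → (∫ v in c..u, ‖B v‖) ≤ ∫ v, ‖B v‖ := fun {u} hu => by
    rw [intervalIntegral.integral_of_le hu]
    exact setIntegral_le_integral hB.norm (Eventually.of_forall fun _ => norm_nonneg _)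
  have hpos : ∀ {u}, c ≤ u → 0 ≤ ∫ v in c..u, ‖B v‖ := fun {u} hu =>
    intervalIntegral.integral_nonneg hu fun _ _ => norm_nonneg _
  set b : ℕ → ℝ := fun n => ‖y₀‖ * ((∫ v, ‖B v‖) ^ n / n.factorial) with hb
  have hbs : Summable b := (Real.summable_pow_div_factorial _).mul_left _
  have hle : ∀ n u, c ≤ u → ‖volterraTerm B y₀ c n u‖ ≤ b n := fun n u hu =>
    (norm_volterraTerm_le hB y₀ hu n).trans (by
      have := hpos hu
      have := hmono hu
      simp only [hb]; gcongr)
  have hsum : ∀ u, c ≤ u → HasSum (fun n => volterraTerm B y₀ c n u)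
      (∑' n, volterraTerm B y₀ c n u) := fun u hu =>
    (hbs.of_norm_bounded (fun n => hle n u hu)).hasSum
  refine ⟨fun u => ∑' n, volterraTerm B y₀ c n u, ?_, fun u hu => ?_, fun u hu => ?_⟩
  · exact continuousOn_tsum (fun n => (continuous_volterraTerm hB y₀ c n).continuousOn) hbs
      fun n u hu => hle n u hu
  · have he := (NormedSpace.expSeries_div_hasSum_exp (∫ v in c..u, ‖B v‖)).mul_left ‖y₀‖
    rw [Real.exp_eq_exp_ℝ]
    exact (hsum u hu).norm_le_of_bounded he fun n => norm_volterraTerm_le hB y₀ hu n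
  · have h1 := (hasSum_nat_add_iff' 1).2 (hsum u hu)
    have h2 : HasSum (fun n => ∫ v in c..u, B v (volterraTerm B y₀ c n v))
        (∫ v in c..u, B v (∑' n, volterraTerm B y₀ c n v)) := by
      refine intervalIntegral.hasSum_integral_of_dominated_convergence
        (fun n v => ‖B v‖ * b n) (fun n => ?_) (fun n => ?_) ?_ ?_ ?_
      · exact (intervalIntegrable_clm_apply hB
          (continuous_volterraTerm hB y₀ c n) c u).def'.aestronglyMeasurable
      · refine Eventually.of_forall fun v hv => ?_
        rw [uIoc_of_le hu] at hv
        exact (B v).le_of_opNorm_le_of_le le_rfl (hle n v hv.1.le)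
      · exact Eventually.of_forall fun v _ => hbs.mul_left _
      · simp only [tsum_mul_left]
        exact (hB.norm.mul_const _).intervalIntegrable
      · refine Eventually.of_forall fun v hv => ?_
        rw [uIoc_of_le hu] at hv
        exact (B v).hasSum (hsum v hv.1.le)
    have h3 := h1.unique h2
    simp only [Finset.range_one, Finset.sum_singleton, volterraTerm] at h3
    rw [← h3]
    abel

/-- If moreover the coefficient is essentially bounded on `[c, d]`, the solution is Lipschitz
there, and it satisfies the differential equation almost everywhere. -/
theorem exists_lipschitz_linear_solution [CompleteSpace F] {c d C : ℝ}
    (hB : IntegrableOn B (Icc c d)) (hC : ∀ᵐ u, u ∈ Icc c d → ‖B u‖ ≤ C) (y₀ : F) :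
    ∃ y : ℝ → F, y c = y₀ ∧ (∃ K, LipschitzOnWith K y (Icc c d)) ∧
      (∀ u ∈ Icc c d, ‖y u‖ ≤ ‖y₀‖ * Real.exp (∫ v in Icc c d, ‖B v‖)) ∧
      ∀ᵐ u, u ∈ Icc c d → HasDerivAt y (B u (y u)) u := by
  set B' := (Icc c d).indicator B with hB'
  have hB'i : Integrable B' := by
    exact IntegrableOn.integrable_indicator (ε' := F →L[ℝ] F) hB measurableSet_Icc
  have hB'e : ∀ u ∈ Icc c d, B' u = B u := fun u hu => indicator_of_mem hu B
  obtain ⟨y, hyc, hyb, hy⟩ := exists_linear_integral_equation hB'i y₀ c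
  set R := ‖y₀‖ * Real.exp (∫ v in Icc c d, ‖B v‖) with hR
  have hbound : ∀ u ∈ Icc c d, ‖y u‖ ≤ R := fun u hu => by
    refine (hyb u hu.1).trans ?_
    rw [hR]
    gcongr
    have h1 : ∫ v in c..u, ‖B' v‖ = ∫ v in Ioc c u, ‖B v‖ := by
      rw [intervalIntegral.integral_of_le hu.1]
      refine setIntegral_congr_fun measurableSet_Ioc fun v hv => ?_
      simp only [hB'e v ⟨hv.1.le, hv.2.trans hu.2⟩]
    rw [h1]
    exact setIntegral_mono_set hB.norm (Eventually.of_forall fun _ => norm_nonneg _)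
      (Eventually.of_forall fun v hv => ⟨hv.1.le, hv.2.trans hu.2⟩)
  have hint : ∀ a ∈ Icc c d, ∀ b ∈ Icc c d,
      IntervalIntegrable (fun v => B' v (y v)) volume a b := by
    intro a ha b hb
    have hsub : uIoc a b ⊆ Icc c d :=
      uIoc_subset_uIcc.trans (ordConnected_Icc.uIcc_subset ha hb)
    rw [intervalIntegrable_iff]
    refine integrableOn_clm_apply hB'i.integrableOn measurableSet_uIoc
      ((hyc.mono fun v hv => (hsub hv).1).aestronglyMeasurable measurableSet_uIoc)
      fun u hu => hbound u (hsub hu)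
  refine ⟨y, by simpa using hy c le_rfl, ?_, hbound, ?_⟩
  · have hRn : 0 ≤ R := by positivity
    refine ⟨(C * R).toNNReal, LipschitzOnWith.of_dist_le_mul fun u hu v hv => ?_⟩
    rw [dist_comm, dist_comm u v, dist_eq_norm, Real.dist_eq, hy u hu.1, hy v hv.1,
      add_sub_add_left_eq_sub]
    have hc : c ∈ Icc c d := ⟨le_rfl, hu.1.trans hu.2⟩
    rw [intervalIntegral.integral_interval_sub_left (hint c hc v hv) (hint c hc u hu)]
    refine (intervalIntegral.norm_integral_le_of_norm_le_const_ae (C := C * R) ?_).trans ?_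
    · filter_upwards [hC] with x hx hxm
      have hxK : x ∈ Icc c d :=
        (uIoc_subset_uIcc.trans (ordConnected_Icc.uIcc_subset hu hv)) hxm
      rw [hB'e x hxK]
      exact (B x).le_of_opNorm_le_of_le (hx hxK) (hbound x hxK)
    · gcongr
      exact Real.le_coe_toNNReal _
  · rcases le_total d c with hdc | hcd
    · have : ∀ᵐ u : ℝ, u ≠ c := by simp [ae_iff, measure_singleton]
      filter_upwards [this] with u hu hum
      exact absurd (le_antisymm (hum.2.trans hdc) hum.1) hu
    have hae := (hint c (left_mem_Icc.2 hcd) d (right_mem_Icc.2 hcd)).ae_hasDerivAt_integral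
    have h1 : ∀ᵐ u : ℝ, u ≠ c := by simp [ae_iff, measure_singleton]
    have h2 : ∀ᵐ u : ℝ, u ≠ d := by simp [ae_iff, measure_singleton]
    filter_upwards [hae, h1, h2] with u hu huc hud hum
    have := hu (by rwa [uIcc_of_le hcd]) c left_mem_uIcc
    rw [hB'e u hum] at this
    refine (this.const_add y₀).congr_of_eventuallyEq ?_
    filter_upwards [Icc_mem_nhds (lt_of_le_of_ne hum.1 huc.symm) (lt_of_le_of_ne hum.2 hud)]
      with v hv using hy v hv.1

end LinearEquation

/-! ### Fundamental solutions in a Banach algebra -/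

/-- `W Y = 1` makes `Y W` a continuous path of idempotents. Since the norm of a nonzero idempotent
is at least `1`, such a path stays equal to `1` if it starts there. -/
theorem mul_eq_one_of_mul_eq_one_of_continuousOn {R : Type*} [NormedRing R]
    {Y W : ℝ → R} {c d : ℝ}
    (hYc : ContinuousOn Y (Icc c d)) (hWc : ContinuousOn W (Icc c d))
    (h0 : Y c * W c = 1) (hWY : ∀ u ∈ Icc c d, W u * Y u = 1) {u : ℝ} (hu : u ∈ Icc c d) :
    Y u * W u = 1 := by
  set q : ℝ → R := fun v => 1 - Y v * W v with hq
  have hqq : ∀ v ∈ Icc c d, q v * q v = q v := fun v hv => by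
    have : Y v * W v * (Y v * W v) = Y v * W v := by
      rw [mul_assoc, ← mul_assoc (W v), hWY v hv, one_mul]
    simp only [hq, mul_sub, sub_mul, one_mul, mul_one, this]
    abel
  have hdich : ∀ v ∈ Icc c d, ‖q v‖ = 0 ∨ 1 ≤ ‖q v‖ := fun v hv => by
    by_cases h : ‖q v‖ = 0
    · exact Or.inl h
    · right
      have hp : 0 < ‖q v‖ := lt_of_le_of_ne (norm_nonneg _) (Ne.symm h)
      have := norm_mul_le (q v) (q v)
      rw [hqq v hv] at this
      exact le_of_mul_le_mul_right (by linarith) hp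
  have hqc : ContinuousOn (fun v => ‖q v‖) (Icc c u) :=
    (continuousOn_const.sub (hYc.mul hWc)).norm.mono (Icc_subset_Icc_right hu.2)
  have hzero : ‖q u‖ = 0 := by
    refine (hdich u hu).resolve_right fun h1 => ?_
    have hmem : (1 / 2 : ℝ) ∈ Icc ‖q c‖ ‖q u‖ := by
      refine ⟨?_, by linarith⟩
      simp only [hq, h0, sub_self, norm_zero]
      norm_num
    obtain ⟨v, hv, hv'⟩ := intermediate_value_Icc hu.1 hqc hmem
    rcases hdich v ⟨hv.1, hv.2.trans hu.2⟩ with h | h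
    · simp only at hv'; linarith
    · simp only at hv'; linarith
  exact (sub_eq_zero.1 (norm_eq_zero.1 hzero)).symm

section FundamentalPair

variable {R : Type*} [NormedRing R] [NormedAlgebra ℝ R]

/-- `Y` solves `Y' = g Y` and `W` solves `W' = -W g` on `[c, d]`, both start at `1` and are bounded
by `N`, and they are inverse to each other. -/
structure IsFundamentalPair (g : ℝ → R) (c d N : ℝ) (Y W : ℝ → R) : Prop where
  lipschitz_left : ∃ K, LipschitzOnWith K Y (Icc c d)
  lipschitz_right : ∃ K, LipschitzOnWith K W (Icc c d)
  apply_left : Y c = 1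
  apply_right : W c = 1
  norm_left_le : ∀ u ∈ Icc c d, ‖Y u‖ ≤ N
  norm_right_le : ∀ u ∈ Icc c d, ‖W u‖ ≤ N
  deriv_left : ∀ᵐ u, u ∈ Icc c d → HasDerivAt Y (g u * Y u) u
  deriv_right : ∀ᵐ u, u ∈ Icc c d → HasDerivAt W (-(W u * g u)) u
  right_mul_left : ∀ u ∈ Icc c d, W u * Y u = 1
  left_mul_right : ∀ u ∈ Icc c d, Y u * W u = 1

/-- The solution `W` for the coefficient `g₁` is close to the inverse of the solution `Y` for `g₂`,
because `(W Y)' = -W (g₁ - g₂) Y`. For `g₁ = g₂` this says that `W Y = 1`. The hypotheses are a part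
of those in `IsFundamentalPair`, for whose construction the lemma is used. -/
theorem norm_mul_sub_one_le {g₁ g₂ Y W : ℝ → R} {c d N : ℝ}
    (hYl : ∃ K, LipschitzOnWith K Y (Icc c d)) (hWl : ∃ K, LipschitzOnWith K W (Icc c d))
    (hY1 : Y c = 1) (hW1 : W c = 1)
    (hYN : ∀ u ∈ Icc c d, ‖Y u‖ ≤ N) (hWN : ∀ u ∈ Icc c d, ‖W u‖ ≤ N)
    (hY : ∀ᵐ u, u ∈ Icc c d → HasDerivAt Y (g₂ u * Y u) u)
    (hW : ∀ᵐ u, u ∈ Icc c d → HasDerivAt W (-(W u * g₁ u)) u)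
    (hg : IntegrableOn (fun u => g₁ u - g₂ u) (Icc c d)) {u : ℝ} (hu : u ∈ Icc c d) :
    ‖W u * Y u - 1‖ ≤ N ^ 2 * ∫ v in Icc c d, ‖g₁ v - g₂ v‖ := by
  obtain ⟨K₁, hK₁⟩ := hYl
  obtain ⟨K₂, hK₂⟩ := hWl
  have hN : 0 ≤ N := (norm_nonneg _).trans (hYN u hu)
  have hsub : uIcc c u ⊆ Icc c d := by
    rw [uIcc_of_le hu.1]; exact Icc_subset_Icc_right hu.2
  have hac : AbsolutelyContinuousOnInterval (fun v => W v * Y v) c u :=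
    ((hK₂.mono hsub).absolutelyContinuousOnInterval).ring_mul
      (hK₁.mono hsub).absolutelyContinuousOnInterval
  have hi : IntegrableOn (fun v => N ^ 2 * ‖g₁ v - g₂ v‖) (Icc c d) := hg.norm.const_mul _
  have hsub' : uIoc c u ⊆ Icc c d := uIoc_subset_uIcc.trans hsub
  have h := hac.norm_sub_le_integral (k := fun v => N ^ 2 * ‖g₁ v - g₂ v‖)
    (intervalIntegrable_iff.2 (hi.mono_set hsub')) (by
      filter_upwards [hY, hW] with v hv hv' hm
      have hm' := hsub hm
      refine ⟨_, (hv' hm').mul (hv hm'), ?_⟩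
      have : -(W v * g₁ v) * Y v + W v * (g₂ v * Y v) = -(W v * (g₁ v - g₂ v) * Y v) := by
        noncomm_ring
      rw [this, norm_neg]
      calc ‖W v * (g₁ v - g₂ v) * Y v‖ ≤ ‖W v‖ * ‖g₁ v - g₂ v‖ * ‖Y v‖ :=
            (norm_mul_le _ _).trans (by gcongr; exact norm_mul_le _ _)
        _ ≤ N * ‖g₁ v - g₂ v‖ * N := by
            gcongr
            · exact hWN v hm'
            · exact hYN v hm'
        _ = _ := by ring)
  rw [hY1, hW1, mul_one] at h
  refine h.trans ?_
  rw [← integral_const_mul]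
  exact setIntegral_mono_set hi (Eventually.of_forall fun _ => by positivity)
    (Eventually.of_forall hsub')

/-- The condition on `‖1‖` includes the zero ring, hence the operators on the zero space. -/
theorem exists_isFundamentalPair [CompleteSpace R] (h1 : ‖(1 : R)‖ ≤ 1) {g : ℝ → R} {c d N : ℝ}
    (hg : IntegrableOn g (Icc c d)) (hb : MemLp g ∞ (volume.restrict (Icc c d)))
    (hN : Real.exp (∫ v in Icc c d, ‖g v‖) ≤ N) :
    ∃ Y W, IsFundamentalPair g c d N Y W := by
  obtain ⟨C, hC⟩ : ∃ C : ℝ, ∀ᵐ u, u ∈ Icc c d → ‖g u‖ ≤ C := by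
    refine ⟨(eLpNormEssSup g (volume.restrict (Icc c d))).toReal, ?_⟩
    have hfin : eLpNormEssSup g (volume.restrict (Icc c d)) ≠ ∞ := by
      simpa using hb.eLpNorm_ne_top
    rw [← ae_restrict_iff' measurableSet_Icc]
    filter_upwards [ae_le_eLpNormEssSup (f := g) (μ := volume.restrict (Icc c d))] with u hu
    simpa using ENNReal.toReal_mono hfin hu
  have key : ∀ L : R →L[ℝ] R →L[ℝ] R, (∀ x, ‖L x‖ ≤ ‖x‖) → ∃ y : ℝ → R, y c = 1 ∧
      (∃ K, LipschitzOnWith K y (Icc c d)) ∧ (∀ u ∈ Icc c d, ‖y u‖ ≤ N) ∧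
      ∀ᵐ u, u ∈ Icc c d → HasDerivAt y (L (g u) (y u)) u := by
    intro L hL
    have hLi : IntegrableOn (fun u => L (g u)) (Icc c d) := L.integrable_comp hg
    obtain ⟨y, hy1, hyl, hyb, hyd⟩ := exists_lipschitz_linear_solution (C := C) hLi
      (by filter_upwards [hC] with u hu hm using (hL _).trans (hu hm)) (1 : R)
    refine ⟨y, hy1, hyl, fun u hu => (hyb u hu).trans (le_trans ?_ hN), hyd⟩
    refine (mul_le_of_le_one_left (Real.exp_pos _).le h1).trans (Real.exp_le_exp.2 ?_)
    exact integral_mono hLi.norm hg.norm fun v => hL _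
  obtain ⟨Y, hY1, hYl, hYN, hYd⟩ := key (ContinuousLinearMap.mul ℝ R)
    fun x => ContinuousLinearMap.opNorm_mul_apply_le ℝ R x
  obtain ⟨W, hW1, hWl, hWN, hWd⟩ := key (-(ContinuousLinearMap.mul ℝ R).flip) fun x => by
    rw [neg_apply, norm_neg]
    refine ContinuousLinearMap.opNorm_le_bound _ (norm_nonneg _) fun z => ?_
    simpa [mul_comm] using norm_mul_le z x
  have hYd' : ∀ᵐ u, u ∈ Icc c d → HasDerivAt Y (g u * Y u) u := by simpa using hYd
  have hWd' : ∀ᵐ u, u ∈ Icc c d → HasDerivAt W (-(W u * g u)) u := by simpa using hWd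
  have hWY : ∀ u ∈ Icc c d, W u * Y u = 1 := fun u hu => by
    have := norm_mul_sub_one_le (g₁ := g) (g₂ := g) hYl hWl hY1 hW1 hYN hWN hYd' hWd'
      (by simp) hu
    rw [← sub_eq_zero, ← norm_le_zero_iff]
    simpa using this
  obtain ⟨K₁, hK₁⟩ := id hYl
  obtain ⟨K₂, hK₂⟩ := id hWl
  exact ⟨Y, W, hYl, hWl, hY1, hW1, hYN, hWN, hYd', hWd', hWY, fun u hu =>
    mul_eq_one_of_mul_eq_one_of_continuousOn hK₁.continuousOn hK₂.continuousOn
      (by rw [hY1, hW1, mul_one]) hWY hu⟩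

/-- Effect of a small step on `W (f ·) * x`, where `x' = A x`: along the step from `r` to `q` the
coefficient `A` is compared with the time-independent one `f' • g (f ·)`, for which `W (f ·) * x`
would be constant; then the fundamental pair of `g` is exchanged for that of `g₁`. -/
theorem norm_mul_le_of_step {A x g g₁ Y W Y₁ W₁ : ℝ → R} {f : ℝ → ℝ} {r q c d N M ε : ℝ}
    (hp : IsFundamentalPair g c d N Y W) (hp₁ : IsFundamentalPair g₁ c d N Y₁ W₁)
    (hgi : IntegrableOn (fun u => g₁ u - g u) (Icc c d))
    (hf : AbsolutelyContinuousOnInterval f r q) (hfK : MapsTo f (uIcc r q) (Icc c d))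
    (hx : AbsolutelyContinuousOnInterval x r q)
    (hxd : ∀ᵐ τ, τ ∈ uIcc r q → HasDerivAt x (A τ * x τ) τ)
    (hxM : ∀ τ ∈ uIcc r q, ‖x τ‖ ≤ M)
    (hA : ∀ᵐ τ, τ ∈ uIcc r q → ‖A τ - deriv f τ • g (f τ)‖ ≤ ε * |deriv f τ|) :
    ‖W₁ (f q) * x q‖ ≤ (1 + N ^ 2 * ∫ v in Icc c d, ‖g₁ v - g v‖) *
      (‖W (f r) * x r‖ + N * ε * M * ∫ τ in uIoc r q, |deriv f τ|) := by
  have hq : f q ∈ Icc c d := hfK right_mem_uIcc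
  have hN : 0 ≤ N := (norm_nonneg _).trans (hp.norm_left_le _ hq)
  have hM : 0 ≤ M := (norm_nonneg _).trans (hxM _ left_mem_uIcc)
  obtain ⟨K, hK⟩ := hp.lipschitz_right
  have hac : AbsolutelyContinuousOnInterval (fun τ => W (f τ) * x τ) r q :=
    (AbsolutelyContinuousOnInterval.lipschitzOn_comp hK hf hfK).ring_mul hx
  have hWf := ae_hasDerivAt_lipschitz_comp hK hp.deriv_right hf hfK
  have h1 := hac.norm_sub_le_integral (k := fun τ => N * ε * M * |deriv f τ|)
    (hf.intervalIntegrable_deriv.abs.const_mul _) (by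
      filter_upwards [hWf, hxd, hA] with τ h1 h2 h3 hm
      refine ⟨_, (h1 hm).mul (h2 hm), ?_⟩
      have : (deriv f τ • -(W (f τ) * g (f τ))) * x τ + W (f τ) * (A τ * x τ) =
          W (f τ) * (A τ - deriv f τ • g (f τ)) * x τ := by
        rw [mul_sub, sub_mul, mul_smul_comm, smul_neg, neg_mul, mul_assoc (W (f τ)) (A τ)]
        abel
      rw [this]
      calc ‖W (f τ) * (A τ - deriv f τ • g (f τ)) * x τ‖
          ≤ ‖W (f τ)‖ * ‖A τ - deriv f τ • g (f τ)‖ * ‖x τ‖ :=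
            (norm_mul_le _ _).trans (by gcongr; exact norm_mul_le _ _)
        _ ≤ N * (ε * |deriv f τ|) * M := by
            gcongr
            · exact mul_nonneg hN ((norm_nonneg _).trans (h3 hm))
            · exact hp.norm_right_le _ (hfK hm)
            · exact h3 hm
            · exact hxM _ hm
        _ = _ := by ring)
  rw [integral_const_mul] at h1
  have h2 : ‖W (f q) * x q‖ ≤
      ‖W (f r) * x r‖ + N * ε * M * ∫ τ in uIoc r q, |deriv f τ| := by
    have := norm_add_le (W (f r) * x r) (W (f q) * x q - W (f r) * x r)
    rw [add_sub_cancel] at this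
    linarith
  have h3 : W₁ (f q) * x q = (1 + (W₁ (f q) * Y (f q) - 1)) * (W (f q) * x q) := by
    rw [add_sub_cancel, mul_assoc, ← mul_assoc (Y (f q)), hp.left_mul_right _ hq, one_mul]
  have h4 := norm_mul_sub_one_le hp.lipschitz_left hp₁.lipschitz_right hp.apply_left
    hp₁.apply_right hp.norm_left_le hp₁.norm_right_le hp.deriv_left hp₁.deriv_right hgi hq
  rw [h3, add_mul, one_mul]
  calc _ ≤ ‖W (f q) * x q‖ + ‖W₁ (f q) * Y (f q) - 1‖ * ‖W (f q) * x q‖ :=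
        (norm_add_le _ _).trans (by gcongr; exact norm_mul_le _ _)
    _ = (1 + ‖W₁ (f q) * Y (f q) - 1‖) * ‖W (f q) * x q‖ := by ring
    _ ≤ _ := by gcongr

end FundamentalPair

/-! ### Discrete Grönwall inequality -/

theorem le_exp_sum_mul_of_succ_le {z δ e : ℕ → ℝ} {n : ℕ} (hδ : ∀ i < n, 0 ≤ δ i) (he : ∀ i < n, 0 ≤ e i)
    (h0 : 0 ≤ z 0) (h : ∀ i < n, z (i + 1) ≤ (1 + δ i) * (z i + e i)) :
    z n ≤ Real.exp (∑ i ∈ Finset.range n, δ i) * (z 0 + ∑ i ∈ Finset.range n, e i) := by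
  induction n with
  | zero => simp
  | succ n ih =>
    have ih' := ih (fun i hi => hδ i (by omega)) (fun i hi => he i (by omega))
      (fun i hi => h i (by omega))
    have hδn := hδ n (by omega)
    have hen := he n (by omega)
    have hS : 0 ≤ ∑ i ∈ Finset.range n, δ i :=
      Finset.sum_nonneg fun i hi => hδ i (by have := Finset.mem_range.1 hi; omega)
    rw [Finset.sum_range_succ, Finset.sum_range_succ, Real.exp_add]
    have hexp1 : 1 ≤ Real.exp (∑ i ∈ Finset.range n, δ i) := Real.one_le_exp hS
    have hexp2 : 1 + δ n ≤ Real.exp (δ n) := by linarith [Real.add_one_le_exp (δ n)]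
    set P := Real.exp (∑ i ∈ Finset.range n, δ i)
    set T := ∑ i ∈ Finset.range n, e i with hTdef
    have hT : 0 ≤ T :=
      Finset.sum_nonneg fun i hi => he i (by have := Finset.mem_range.1 hi; omega)
    calc z (n + 1) ≤ (1 + δ n) * (z n + e n) := h n (by omega)
      _ ≤ (1 + δ n) * (P * (z 0 + T) + P * e n) := by
          gcongr
          nlinarith
      _ = (1 + δ n) * (P * (z 0 + (T + e n))) := by ring
      _ ≤ Real.exp (δ n) * (P * (z 0 + (T + e n))) := by gcongr
      _ = _ := by ring

/-- The time reversal of `le_exp_sum_mul_of_succ_le`. -/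
theorem le_exp_sum_mul_of_le_succ {z δ e : ℕ → ℝ} {n : ℕ} (hδ : ∀ i < n, 0 ≤ δ i)
    (he : ∀ i < n, 0 ≤ e i) (h0 : 0 ≤ z n) (h : ∀ i < n, z i ≤ (1 + δ i) * (z (i + 1) + e i)) :
    z 0 ≤ Real.exp (∑ i ∈ Finset.range n, δ i) * (z n + ∑ i ∈ Finset.range n, e i) := by
  have := le_exp_sum_mul_of_succ_le (z := fun i => z (n - i)) (δ := fun i => δ (n - 1 - i))
    (e := fun i => e (n - 1 - i)) (n := n) (fun i hi => hδ _ (by omega))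
    (fun i hi => he _ (by omega)) (by simpa using h0) (fun i hi => by
      have := h (n - 1 - i) (by omega)
      have hi' : n - 1 - i = n - (i + 1) := by omega
      rw [show n - 1 - i + 1 = n - i by omega, hi'] at this
      rwa [hi'])
  simpa [Finset.sum_range_reflect] using this

/-! ### Families of integrable functions of bounded variation -/

section L1Family

variable {F : Type*} [NormedAddCommGroup F] {G : ℝ → ℝ → F} {I J : Set ℝ}

theorem sum_l1Norm_le_l1Variation {a : ℕ → ℝ} (ha : StrictMono a) {n : ℕ}
    (haI : ∀ i ≤ n, a i ∈ I) :
    ∑ i ∈ Finset.range n, l1Norm J (fun u => G (a (i + 1)) u - G (a i) u) ≤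
      l1Variation G I J := by
  rw [Finset.sum_range]
  refine le_trans (le_of_eq ?_) (le_iSup_of_le n (le_iSup_of_le (fun i : Fin (n + 1) => a i)
    (le_iSup_of_le (fun i j hij => ha hij) (le_iSup_of_le
      (fun i => haI i (Nat.lt_succ_iff.1 i.2)) le_rfl))))
  simp

theorem l1Norm_sub_le_l1Variation {r q : ℝ} (hr : r ∈ I) (hq : q ∈ I) :
    l1Norm J (fun u => G q u - G r u) ≤ l1Variation G I J := by
  wlog h : r ≤ q generalizing r q
  · refine le_trans (le_of_eq ?_) (this hq hr (le_of_not_ge h))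
    simp only [l1Norm, enorm_sub_rev]
  rcases h.eq_or_lt with rfl | h
  · simp [l1Norm]
  let a : Fin 2 → ℝ := ![r, q]
  refine le_trans (le_of_eq ?_) (le_iSup_of_le 1 (le_iSup_of_le a
    (le_iSup_of_le ?_ (le_iSup_of_le ?_ le_rfl))))
  · simp [a]
  · rw [Fin.strictMono_iff_lt_succ]
    simpa [a] using h
  · intro i
    fin_cases i <;> simpa [a]

theorem iSup_l1Norm_lt_top (hGint : ∀ t ∈ I, IntegrableOn (G t) J volume)
    (hGvar : l1Variation G I J < ∞) : ⨆ t ∈ I, l1Norm J (G t) < ∞ := by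
  rcases I.eq_empty_or_nonempty with rfl | ⟨t₀, ht₀⟩
  · simp
  have h0 : l1Norm J (G t₀) < ∞ := (hGint t₀ ht₀).2
  refine lt_of_le_of_lt (iSup₂_le fun t ht => ?_) (ENNReal.add_lt_top.2 ⟨h0, hGvar⟩)
  calc l1Norm J (G t) ≤ ∫⁻ u in J, (‖G t₀ u‖ₑ + ‖G t u - G t₀ u‖ₑ) := by
        refine lintegral_mono fun u => ?_
        have := enorm_add_le (G t₀ u) (G t u - G t₀ u)
        rwa [add_sub_cancel] at this
    _ = l1Norm J (G t₀) + l1Norm J (fun u => G t u - G t₀ u) :=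
        lintegral_add_left' (hGint t₀ ht₀).1.enorm _
    _ ≤ _ := by gcongr; exact l1Norm_sub_le_l1Variation ht₀ ht

theorem setIntegral_norm_le_toReal_l1Norm {y : ℝ → F} {K : Set ℝ} (hy : IntegrableOn y J)
    (hK : K ⊆ J) : ∫ u in K, ‖y u‖ ≤ (l1Norm J y).toReal := by
  rw [integral_norm_eq_lintegral_enorm (hy.mono_set hK).aestronglyMeasurable]
  exact ENNReal.toReal_mono hy.2.ne (lintegral_mono_set hK)

/-- Uniform continuity on compact intervals. The supremum distance on functions `J → F` is the
extended distance of Mathlib's space of uniform convergence. -/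
theorem SupDistContinuousOn.exists_forall_norm_sub_le (hG : SupDistContinuousOn G I J) {a b : ℝ}
    (hab : Icc a b ⊆ I) {ε : ℝ} (hε : 0 < ε) :
    ∃ δ > 0, ∀ x ∈ Icc a b, ∀ y ∈ Icc a b, dist x y < δ → ∀ u ∈ J, ‖G x u - G y u‖ ≤ ε := by
  let Γ : ℝ → UniformFun J F := fun t => UniformFun.ofFun fun u : J => G t u
  have hΓ : ∀ x y, edist (Γ x) (Γ y) = supDist J (G x) (G y) := fun x y => by
    rw [UniformFun.edist_def, supDist, iSup_subtype']
    rfl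
  have hc : ContinuousOn Γ (Icc a b) := fun t ht => by
    refine ContinuousWithinAt.mono ?_ hab
    rw [ContinuousWithinAt, tendsto_iff_edist_tendsto_0]
    simpa only [hΓ] using hG t (hab ht)
  have hu := isCompact_Icc.uniformContinuousOn_of_continuous hc
  rw [EMetric.uniformContinuousOn_iff] at hu
  obtain ⟨δ, hδ, h⟩ := hu (ENNReal.ofReal ε) (by simpa using hε)
  obtain ⟨δ', hδ'0, hδ'⟩ := ENNReal.lt_iff_exists_real_btwn.1 hδ
  refine ⟨δ', by simpa using hδ'.1, fun x hx y hy hxy u hu => ?_⟩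
  have h1 : edist x y < δ := by
    rw [edist_dist]
    exact lt_of_le_of_lt (ENNReal.ofReal_le_ofReal hxy.le) hδ'.2
  have h2 := (h hx hy h1).le
  rw [hΓ, supDist] at h2
  have h3 := (le_iSup₂ (f := fun u (_ : u ∈ J) => edist (G x u) (G y u)) u hu).trans h2
  rw [edist_dist, ENNReal.ofReal_le_ofReal_iff hε.le, dist_eq_norm] at h3
  exact h3

end L1Family

/-- The endpoints are the extreme values of `f`, so `[c, d]` is the image of `[a, b]`. -/
theorem LocallyAbsolutelyContinuousOn.exists_image_Icc {f : ℝ → ℝ} {I J : Set ℝ}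
    (hf : LocallyAbsolutelyContinuousOn f I) (hfJ : MapsTo f I J) {a b : ℝ} (hab : a ≤ b)
    (hI : Icc a b ⊆ I) : ∃ c d, MapsTo f (Icc a b) (Icc c d) ∧ Icc c d ⊆ J := by
  have hc := (hf a b hab hI).continuousOn
  rw [uIcc_of_le hab] at hc
  refine ⟨_, _, (mapsTo_image f _).mono_right (hc.image_Icc hab).le, ?_⟩
  rw [← hc.image_Icc hab]
  exact (hfJ.mono_left hI).image_subset

/-- Inside an interval `[a, b] ⊆ I`, the derivative within `I` is the derivative. -/
theorem ae_eq_deriv_smul {F : Type*} [NormedAddCommGroup F] [NormedSpace ℝ F]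
    {I : Set ℝ} {f : ℝ → ℝ} {A : ℝ → F} {h : ℝ → F}
    (hA : ∀ t ∈ I, A t = derivWithin f I t • h t) {a b : ℝ} (hab : Icc a b ⊆ I) :
    ∀ᵐ t, t ∈ Icc a b → A t = deriv f t • h t := by
  have h1 : ∀ᵐ u : ℝ, u ≠ a := by simp [ae_iff, measure_singleton]
  have h2 : ∀ᵐ u : ℝ, u ≠ b := by simp [ae_iff, measure_singleton]
  filter_upwards [h1, h2] with t hta htb ht
  rw [hA t (hab ht), derivWithin_of_mem_nhds]
  exact mem_of_superset
    (Icc_mem_nhds (lt_of_le_of_ne ht.1 hta.symm) (lt_of_le_of_ne ht.2 htb)) hab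

/-! ### Operator solutions -/

section OperatorSolution

variable {E : Type*} [NormedAddCommGroup E] [NormedSpace ℝ E] {I : Set ℝ} {A x : ℝ → E →L[ℝ] E}

theorem IsOperatorSolution.absolutelyContinuousOnInterval (hx : IsOperatorSolution I A x)
    {a b : ℝ} (hab : a ≤ b) (hI : Icc a b ⊆ I) : AbsolutelyContinuousOnInterval x a b := by
  have hint : IntervalIntegrable (fun τ => (A τ).comp (x τ)) volume a b :=
    (intervalIntegrable_iff_integrableOn_Icc_of_le hab).2 (hx.memL1Loc a b hI)
  refine (AbsolutelyContinuousOnInterval.primitive hint left_mem_uIcc).of_dist_le_mul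
    (C := 1) fun p hp q hq => ?_
  rw [uIcc_of_le hab] at hp hq
  have ha : a ∈ I := hI (left_mem_Icc.2 hab)
  rw [one_mul, ← hx.sub_eq_integral a ha p (hI hp), ← hx.sub_eq_integral a ha q (hI hq),
    dist_sub_right]

theorem IsOperatorSolution.ae_hasDerivAt [CompleteSpace E] (hx : IsOperatorSolution I A x)
    {a b : ℝ} (hab : a ≤ b) (hI : Icc a b ⊆ I) :
    ∀ᵐ τ, τ ∈ Icc a b → HasDerivAt x (A τ * x τ) τ := by
  have hint : IntervalIntegrable (fun τ => (A τ).comp (x τ)) volume a b :=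
    (intervalIntegrable_iff_integrableOn_Icc_of_le hab).2 (hx.memL1Loc a b hI)
  have h1 : ∀ᵐ u : ℝ, u ≠ a := by simp [ae_iff, measure_singleton]
  have h2 : ∀ᵐ u : ℝ, u ≠ b := by simp [ae_iff, measure_singleton]
  filter_upwards [hint.ae_hasDerivAt_integral, h1, h2] with τ h hτa hτb hτ
  have hd := h (by rwa [uIcc_of_le hab]) a left_mem_uIcc
  refine (hd.const_add (x a)).congr_of_eventuallyEq ?_
  filter_upwards [Icc_mem_nhds (lt_of_le_of_ne hτ.1 hτa.symm) (lt_of_le_of_ne hτ.2 hτb)]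
    with q hq
  rw [← hx.sub_eq_integral a (hI (left_mem_Icc.2 hab)) q (hI hq), add_sub_cancel]

theorem IsOperatorSolution.intervalIntegrable (hI : I.OrdConnected)
    (hx : IsOperatorSolution I A x) {s t : ℝ} (hs : s ∈ I) (ht : t ∈ I) :
    IntervalIntegrable (fun τ => (A τ).comp (x τ)) volume s t := by
  rw [intervalIntegrable_iff']
  exact hx.memL1Loc _ _ (hI.uIcc_subset hs ht)

theorem IsOperatorSolution.mul_const [CompleteSpace E] (hI : I.OrdConnected) (hx : IsOperatorSolution I A x) (C : E →L[ℝ] E) :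
    IsOperatorSolution I A (fun t => x t * C) := by
  refine ⟨hx.continuousOn.mul continuousOn_const, fun a b hab => ?_, fun s hs t ht => ?_⟩
  · exact (hx.memL1Loc a b hab).mul_const C
  · have := hx.sub_eq_integral s hs t ht
    rw [← sub_mul, this]
    exact (((ContinuousLinearMap.mul ℝ (E →L[ℝ] E)).flip C).intervalIntegral_comp_comm
      (hx.intervalIntegrable hI hs ht)).symm

theorem IsOperatorSolution.sub [CompleteSpace E] (hI : I.OrdConnected) {y : ℝ → E →L[ℝ] E}
    (hx : IsOperatorSolution I A x) (hy : IsOperatorSolution I A y) :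
    IsOperatorSolution I A (fun t => x t - y t) := by
  refine ⟨hx.continuousOn.sub hy.continuousOn, fun a b hab => ?_, fun s hs t ht => ?_⟩
  · simp only [ContinuousLinearMap.comp_sub]
    exact (hx.memL1Loc a b hab).sub (hy.memL1Loc a b hab)
  · simp only [ContinuousLinearMap.comp_sub]
    rw [intervalIntegral.integral_sub (hx.intervalIntegrable hI hs ht)
      (hy.intervalIntegrable hI hs ht), ← hx.sub_eq_integral s hs t ht,
      ← hy.sub_eq_integral s hs t ht]
    abel

end OperatorSolution

section SolutionBound

variable {E : Type*} [NormedAddCommGroup E] [NormedSpace ℝ E] [CompleteSpace E]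
  {I J : Set ℝ} {G : ℝ → ℝ → E →L[ℝ] E} {f : ℝ → ℝ} {A x : ℝ → E →L[ℝ] E}

/-- A solution changes between two times, in either direction of time, by a factor that does not
depend on `f`. On a partition with mesh so small that `G` varies by at most `ε`, the errors made in
`norm_mul_le_of_step` add up to a factor controlled by `V`, and a term of order `ε` that depends on
`f` and on the solution but disappears for `ε → 0`. -/
theorem IsOperatorSolution.norm_le_and_norm_le {V N : ℝ} (hx : IsOperatorSolution I A x)
    (hGloc : ∀ t ∈ I, MemLInftyLoc J (G t)) (hGint : ∀ t ∈ I, IntegrableOn (G t) J volume)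
    (hGcont : SupDistContinuousOn G I J) (hGvar : l1Variation G I J < ∞)
    (hV : V = (l1Variation G I J).toReal)
    (hN : ∀ t ∈ I, Real.exp (l1Norm J (G t)).toReal ≤ N)
    (hf : LocallyAbsolutelyContinuousOn f I) (hfJ : MapsTo f I J)
    (hA : ∀ t ∈ I, A t = derivWithin f I t • G t (f t)) {s t : ℝ} (hst : s ≤ t)
    (hI : Icc s t ⊆ I) :
    ‖x t‖ ≤ N ^ 2 * Real.exp (N ^ 2 * V) * ‖x s‖ ∧
      ‖x s‖ ≤ N ^ 2 * Real.exp (N ^ 2 * V) * ‖x t‖ := by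
  have hsI : s ∈ I := hI (left_mem_Icc.2 hst)
  have hN1 : 1 ≤ N := le_trans (Real.one_le_exp ENNReal.toReal_nonneg) (hN s hsI)
  have hN0 : 0 ≤ N := zero_le_one.trans hN1
  have hV0 : 0 ≤ V := hV ▸ ENNReal.toReal_nonneg
  rcases hst.eq_or_lt with rfl | hlt
  · have h1 : 1 ≤ N ^ 2 * Real.exp (N ^ 2 * V) :=
      one_le_mul_of_one_le_of_one_le (one_le_pow₀ hN1) (Real.one_le_exp (by positivity))
    have := le_mul_of_one_le_left (norm_nonneg (x s)) h1
    exact ⟨this, this⟩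
  obtain ⟨c, d, hfK, hKJ⟩ := hf.exists_image_Icc hfJ hst hI
  have hex : ∀ r, ∃ Y W, r ∈ Icc s t → IsFundamentalPair (G r) c d N Y W := by
    intro r
    by_cases hr : r ∈ Icc s t
    · obtain ⟨Y, W, h⟩ := exists_isFundamentalPair (g := G r) (c := c) (d := d) (N := N)
        ContinuousLinearMap.norm_id_le ((hGint r (hI hr)).mono_set hKJ)
        (hGloc r (hI hr) c d hKJ)
        ((Real.exp_le_exp.2 (setIntegral_norm_le_toReal_l1Norm (hGint r (hI hr)) hKJ)).trans
          (hN r (hI hr)))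
      exact ⟨Y, W, fun _ => h⟩
    · exact ⟨0, 0, fun h => absurd h hr⟩
  choose Y W hp using hex
  have hfac := hf s t hst hI
  have hxac := hx.absolutelyContinuousOnInterval hst hI
  have hxd := hx.ae_hasDerivAt hst hI
  have hAae := ae_eq_deriv_smul (F := E →L[ℝ] E) (h := fun t => G t (f t)) hA hI
  obtain ⟨M, hM⟩ := isCompact_Icc.exists_bound_of_continuousOn (hx.continuousOn.mono hI)
  -- `z r` measures the solution after removing the flow of the coefficient frozen at time `r`
  set z : ℝ → ℝ := fun r => ‖W r (f r) * x r‖ with hz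
  have hz0 : ∀ r, 0 ≤ z r := fun r => norm_nonneg _
  have hzx : ∀ r ∈ Icc s t, z r ≤ N * ‖x r‖ := fun r hr =>
    (norm_mul_le _ _).trans (by gcongr; exact (hp r hr).norm_right_le _ (hfK hr))
  have hxz : ∀ r ∈ Icc s t, ‖x r‖ ≤ N * z r := fun r hr => by
    have h1 : x r = Y r (f r) * (W r (f r) * x r) := by
      rw [← mul_assoc, (hp r hr).left_mul_right _ (hfK hr), one_mul]
    calc ‖x r‖ = ‖Y r (f r) * (W r (f r) * x r)‖ := by rw [← h1]
      _ ≤ _ := (norm_mul_le _ _).trans (by gcongr; exact (hp r hr).norm_left_le _ (hfK hr))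
  set Φ := ∫ τ in s..t, |deriv f τ| with hΦ
  have key : ∀ ε > 0, z t ≤ Real.exp (N ^ 2 * V) * (z s + ε * (N * M * Φ)) ∧
      z s ≤ Real.exp (N ^ 2 * V) * (z t + ε * (N * M * Φ)) := by
    intro ε hε
    obtain ⟨η, hη, hunif⟩ := hGcont.exists_forall_norm_sub_le hI hε
    obtain ⟨n, hn⟩ := exists_nat_gt ((t - s) / η)
    have hts : 0 < t - s := sub_pos.2 hlt
    have hn0 : (0 : ℝ) < n := (div_pos hts hη).trans hn
    have hmesh0 : 0 < (t - s) / n := div_pos hts hn0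
    have hmesh : (t - s) / n < η := by
      rw [div_lt_iff₀ hη] at hn
      rw [div_lt_iff₀ hn0]
      linarith
    set a : ℕ → ℝ := fun i => s + i * ((t - s) / n) with ha
    have ha0 : a 0 = s := by simp [ha]
    have han : a n = t := by
      simp only [ha]
      field_simp
      ring
    have hasucc : ∀ i, a (i + 1) = a i + (t - s) / n := fun i => by
      simp only [ha]
      push_cast
      ring
    have hamono : StrictMono a := strictMono_nat_of_lt_succ fun i => by
      rw [hasucc]
      linarith
    have hamem : ∀ i ≤ n, a i ∈ Icc s t := fun i hi =>
      ⟨ha0 ▸ hamono.monotone (Nat.zero_le i), han ▸ hamono.monotone hi⟩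
    have hstep : ∀ r ∈ Icc s t, ∀ q ∈ Icc s t, dist r q < η →
        z q ≤ (1 + N ^ 2 * ∫ v in Icc c d, ‖G q v - G r v‖) *
          (z r + N * ε * M * ∫ τ in uIoc r q, |deriv f τ|) := by
      intro r hr q hq hrq
      have hsub : uIcc r q ⊆ Icc s t := ordConnected_Icc.uIcc_subset hr hq
      have hsub' : uIcc r q ⊆ uIcc s t := by rwa [uIcc_of_le hst]
      refine norm_mul_le_of_step (A := A) (hp r hr) (hp q hq)
        (((hGint q (hI hq)).sub (hGint r (hI hr))).mono_set hKJ) (hfac.mono hsub')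
        (hfK.mono_left hsub) (hxac.mono hsub') ?_ (fun τ hτ => hM τ (hsub hτ)) ?_
      · filter_upwards [hxd] with τ h hτ using h (hsub hτ)
      · filter_upwards [hAae] with τ h hτ
        have hτ' := hsub hτ
        rw [h hτ', ← smul_sub, norm_smul, Real.norm_eq_abs, mul_comm]
        gcongr
        refine hunif τ hτ' r hr (lt_of_le_of_lt ?_ hrq) _ (hKJ (hfK hτ'))
        rw [Real.dist_eq, Real.dist_eq, abs_sub_comm r q]
        exact abs_sub_left_of_mem_uIcc hτ
    have hdist : ∀ i, dist (a i) (a (i + 1)) < η := fun i => by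
      rw [hasucc, Real.dist_eq, sub_add_cancel_left, abs_neg, abs_of_pos hmesh0]
      exact hmesh
    set δ : ℕ → ℝ := fun i => N ^ 2 * ∫ v in Icc c d, ‖G (a (i + 1)) v - G (a i) v‖ with hδ
    set e : ℕ → ℝ := fun i => N * ε * M * ∫ τ in uIoc (a i) (a (i + 1)), |deriv f τ| with he
    have hM0 : 0 ≤ M := (norm_nonneg _).trans (hM s (left_mem_Icc.2 hst))
    have hδ0 : ∀ i < n, 0 ≤ δ i := fun i _ =>
      mul_nonneg (by positivity) (integral_nonneg fun _ => norm_nonneg _)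
    have he0 : ∀ i < n, 0 ≤ e i := fun i _ =>
      mul_nonneg (by positivity) (integral_nonneg fun _ => abs_nonneg _)
    have hδsum : ∑ i ∈ Finset.range n, δ i ≤ N ^ 2 * V := by
      rw [← Finset.mul_sum, hV]
      gcongr
      have hsum := sum_l1Norm_le_l1Variation (G := G) (I := I) (J := J) hamono (n := n)
        fun i hi => hI (hamem i hi)
      have hfin : ∀ i ∈ Finset.range n,
          l1Norm J (fun u => G (a (i + 1)) u - G (a i) u) ≠ ∞ := fun i hi =>
        ((ENNReal.sum_ne_top.1 (hsum.trans_lt hGvar).ne) i hi)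
      refine le_trans ?_ (ENNReal.toReal_mono hGvar.ne hsum)
      rw [ENNReal.toReal_sum hfin]
      refine Finset.sum_le_sum fun i hi => ?_
      have hi' := Finset.mem_range.1 hi
      exact setIntegral_norm_le_toReal_l1Norm
        ((hGint _ (hI (hamem _ hi'))).sub (hGint _ (hI (hamem _ hi'.le)))) hKJ
    have hesum : ∑ i ∈ Finset.range n, e i = ε * (N * M * Φ) := by
      have h1 : ∀ i ∈ Finset.range n, (∫ τ in uIoc (a i) (a (i + 1)), |deriv f τ|) =
          ∫ τ in (a i)..(a (i + 1)), |deriv f τ| := fun i _ => by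
        rw [intervalIntegral.integral_of_le (hamono.monotone i.le_succ),
          uIoc_of_le (hamono.monotone i.le_succ)]
      rw [← Finset.mul_sum, Finset.sum_congr rfl h1,
        intervalIntegral.sum_integral_adjacent_intervals, ha0, han]
      · ring
      · intro i hi
        refine hfac.intervalIntegrable_deriv.abs.mono_set ?_
        rw [uIcc_of_le hst]
        exact ordConnected_Icc.uIcc_subset (hamem i hi.le) (hamem (i + 1) hi)
    have hforward := le_exp_sum_mul_of_succ_le (z := fun i => z (a i)) hδ0 he0 (hz0 _)
      fun i hi => hstep _ (hamem i hi.le) _ (hamem (i + 1) hi) (hdist i)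
    have hbackward := le_exp_sum_mul_of_le_succ (z := fun i => z (a i)) hδ0 he0 (hz0 _)
      fun i hi => by
        have := hstep _ (hamem (i + 1) hi) _ (hamem i hi.le) (by rw [dist_comm]; exact hdist i)
        rw [uIoc_comm] at this
        simpa only [norm_sub_rev (G (a i) _)] using this
    simp only [ha0, han] at hforward hbackward
    rw [hesum] at hforward hbackward
    have hsum0 : 0 ≤ ε * (N * M * Φ) := hesum ▸ Finset.sum_nonneg fun i hi =>
      he0 i (Finset.mem_range.1 hi)
    have hzs := hz0 s
    have hzt := hz0 t
    exact ⟨hforward.trans (by gcongr), hbackward.trans (by gcongr)⟩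
  have hlim : ∀ b : ℝ, Tendsto (fun ε : ℝ => Real.exp (N ^ 2 * V) * (b + ε * (N * M * Φ)))
      (𝓝[>] 0) (𝓝 (Real.exp (N ^ 2 * V) * b)) := fun b => by
    have : ContinuousAt (fun ε : ℝ => Real.exp (N ^ 2 * V) * (b + ε * (N * M * Φ))) 0 := by
      fun_prop
    simpa [ContinuousAt] using this.tendsto.mono_left nhdsWithin_le_nhds
  have hconcl : ∀ p ∈ Icc s t, ∀ q ∈ Icc s t, z q ≤ Real.exp (N ^ 2 * V) * z p →
      ‖x q‖ ≤ N ^ 2 * Real.exp (N ^ 2 * V) * ‖x p‖ := fun p hpm q hqm h =>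
    calc ‖x q‖ ≤ N * z q := hxz q hqm
      _ ≤ N * (Real.exp (N ^ 2 * V) * (N * ‖x p‖)) := by
          gcongr
          exact h.trans (by gcongr; exact hzx p hpm)
      _ = _ := by ring
  have hs' : s ∈ Icc s t := left_mem_Icc.2 hst
  have ht' : t ∈ Icc s t := right_mem_Icc.2 hst
  exact ⟨hconcl s hs' t ht' (ge_of_tendsto (hlim _)
      (eventually_nhdsWithin_of_forall fun ε hε => (key ε hε).1)),
    hconcl t ht' s hs' (ge_of_tendsto (hlim _)
      (eventually_nhdsWithin_of_forall fun ε hε => (key ε hε).2))⟩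

end SolutionBound

/-! ### Local integrability of the coefficient -/

section LocalIntegrability

variable {F : Type*} [NormedAddCommGroup F] [NormedSpace ℝ F]

/-- The composition `g ∘ f` need not be measurable, but multiplication with `f'` makes changes of `g`
on null sets invisible. -/
theorem aestronglyMeasurable_deriv_smul_comp {f : ℝ → ℝ} {g : ℝ → F} {a b c d : ℝ} (hab : a ≤ b)
    (hf : AbsolutelyContinuousOnInterval f a b) (hfK : MapsTo f (Icc a b) (Icc c d))
    (hg : AEStronglyMeasurable g (volume.restrict (Icc c d))) :
    AEStronglyMeasurable (fun t => deriv f t • g (f t)) (volume.restrict (Icc a b)) := by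
  have hfc := hf.continuousOn
  have hfd := hf.ae_differentiableAt
  rw [uIcc_of_le hab] at hfc hfd
  have hfm : AEMeasurable f (volume.restrict (Icc a b)) := hfc.aemeasurable measurableSet_Icc
  have hdm : AEStronglyMeasurable (deriv f) (volume.restrict (Icc a b)) :=
    (stronglyMeasurable_deriv f).aestronglyMeasurable
  have hmk : AEStronglyMeasurable (fun t => hg.mk g (f t)) (volume.restrict (Icc a b)) :=
    (hg.stronglyMeasurable_mk.aestronglyMeasurable (μ := _)).comp_aemeasurable hfm
  refine (hdm.smul hmk).congr ?_
  have hae := (ae_restrict_iff' measurableSet_Icc).1 hg.ae_eq_mk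
  have h0 := ae_deriv_eq_zero_of_mem_null (f := f) (ae_iff.1 hae)
  rw [EventuallyEq, ae_restrict_iff' measurableSet_Icc]
  filter_upwards [h0, hfd] with t ht htd htm
  by_cases h : f t ∈ Icc c d → g (f t) = hg.mk g (f t)
  · simp only [Pi.smul_apply', h (hfK htm)]
  · have := ht h _ (htd htm).hasDerivAt
    simp [this]

theorem ae_norm_deriv_smul_comp_le {f : ℝ → ℝ} {g : ℝ → F} {a b c d : ℝ} (hab : a ≤ b)
    (hf : AbsolutelyContinuousOnInterval f a b) (hfK : MapsTo f (Icc a b) (Icc c d))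
    (hg : MemLp g ∞ (volume.restrict (Icc c d))) :
    ∃ C : ℝ, ∀ᵐ t, t ∈ Icc a b → ‖deriv f t • g (f t)‖ ≤ C * |deriv f t| := by
  have hfd := hf.ae_differentiableAt
  rw [uIcc_of_le hab] at hfd
  refine ⟨(eLpNormEssSup g (volume.restrict (Icc c d))).toReal, ?_⟩
  have hfin : eLpNormEssSup g (volume.restrict (Icc c d)) ≠ ∞ := by
    simpa using hg.eLpNorm_ne_top
  have hae : ∀ᵐ u, u ∈ Icc c d →
      ‖g u‖ ≤ (eLpNormEssSup g (volume.restrict (Icc c d))).toReal := by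
    rw [← ae_restrict_iff' measurableSet_Icc]
    filter_upwards [ae_le_eLpNormEssSup (f := g) (μ := volume.restrict (Icc c d))] with u hu
    simpa using ENNReal.toReal_mono hfin hu
  filter_upwards [ae_deriv_eq_zero_of_mem_null (f := f) (ae_iff.1 hae), hfd] with t ht htd htm
  rw [norm_smul, mul_comm, Real.norm_eq_abs]
  by_cases h : f t ∈ Icc c d → ‖g (f t)‖ ≤ (eLpNormEssSup g (volume.restrict (Icc c d))).toReal
  · gcongr
    exact h (hfK htm)
  · simp [ht h _ (htd htm).hasDerivAt]

/-- The coefficient is a limit of the functions `t ↦ f' t • G (ρ t) (f t)` with `ρ` countably valued,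
hence measurable; locally it is dominated by a multiple of `|f'|`. -/
theorem memL1Loc_deriv_smul {I J : Set ℝ} {G : ℝ → ℝ → F} {f : ℝ → ℝ} {A : ℝ → F}
    (hGloc : ∀ t ∈ I, MemLInftyLoc J (G t)) (hGcont : SupDistContinuousOn G I J)
    (hf : LocallyAbsolutelyContinuousOn f I) (hfJ : MapsTo f I J)
    (hA : ∀ t ∈ I, A t = derivWithin f I t • G t (f t)) : MemL1Loc I A := by
  intro a b hI
  rcases lt_or_ge b a with hba | hab
  · simp [Icc_eq_empty_of_lt hba]
  obtain ⟨c, d, hfK, hKJ⟩ := hf.exists_image_Icc hfJ hab hI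
  have hfac := hf a b hab hI
  have hAae := ae_eq_deriv_smul (h := fun t => G t (f t)) hA hI
  have hdi : IntegrableOn (deriv f) (Icc a b) :=
    (intervalIntegrable_iff_integrableOn_Icc_of_le hab).1 hfac.intervalIntegrable_deriv
  have hmeas : AEStronglyMeasurable A (volume.restrict (Icc a b)) := by
    -- `ρ n t` approximates `t` from within `[a, b]` and takes countably many values
    let ρ : ℕ → ℝ → ℝ := fun n t => max a (⌊t * (n + 1)⌋ / (n + 1))
    have hρ : ∀ n, ∀ t ∈ Icc a b, ρ n t ∈ Icc a b := fun n t ht => by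
      refine ⟨le_max_left _ _, max_le hab (le_trans ?_ ht.2)⟩
      rw [div_le_iff₀ (by positivity)]
      exact Int.floor_le _
    have hρlim : ∀ t ∈ Icc a b, Tendsto (fun n => ρ n t) atTop (𝓝[I] t) := fun t ht => by
      refine tendsto_nhdsWithin_iff.2 ⟨?_, Eventually.of_forall fun n => hI (hρ n t ht)⟩
      have h1 : Tendsto (fun n : ℕ => t - 1 / ((n : ℝ) + 1)) atTop (𝓝 t) := by
        simpa using tendsto_const_nhds.sub (tendsto_one_div_add_atTop_nhds_zero_nat (𝕜 := ℝ))
      refine tendsto_of_tendsto_of_tendsto_of_le_of_le h1 tendsto_const_nhds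
        (fun n => ?_) (fun n => ?_)
      · refine le_trans ?_ (le_max_right _ _)
        have hn : (0 : ℝ) < n + 1 := by positivity
        rw [le_div_iff₀ hn, sub_mul, one_div, inv_mul_cancel₀ hn.ne']
        exact (Int.sub_one_lt_floor _).le
      · refine max_le ht.1 ?_
        rw [div_le_iff₀ (by positivity)]
        exact Int.floor_le _
    refine aestronglyMeasurable_of_tendsto_ae atTop
      (f := fun n t => deriv f t • G (ρ n t) (f t)) (fun n => ?_) ?_
    · let S : ℤ → Set ℝ := fun k => Icc a b ∩ {t | ⌊t * (n + 1)⌋ = k}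
      have hSU : Icc a b = ⋃ k, S k := by
        ext t
        simp [S]
      rw [hSU, aestronglyMeasurable_iUnion_iff]
      intro k
      have hSm : MeasurableSet (S k) := measurableSet_Icc.inter
        ((Int.measurable_floor.comp (measurable_id.mul_const _)) (measurableSet_singleton k))
      rcases (S k).eq_empty_or_nonempty with h | ⟨t₀, ht₀⟩
      · rw [h, Measure.restrict_empty]
        exact aestronglyMeasurable_zero_measure _
      · have hr : ρ n t₀ ∈ Icc a b := hρ n t₀ ht₀.1
        refine ((aestronglyMeasurable_deriv_smul_comp hab hfac hfK
          (hGloc _ (hI hr) c d hKJ).aestronglyMeasurable).mono_set inter_subset_left).congr ?_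
        rw [EventuallyEq, ae_restrict_iff' hSm]
        refine Eventually.of_forall fun t ht => ?_
        have : ρ n t = ρ n t₀ := by
          simp only [ρ]
          rw [ht.2, ht₀.2]
        simp only [this]
    · rw [ae_restrict_iff' measurableSet_Icc]
      filter_upwards [hAae] with t h ht
      rw [h ht]
      refine Tendsto.const_smul ?_ _
      rw [tendsto_iff_edist_tendsto_0]
      refine tendsto_of_tendsto_of_tendsto_of_le_of_le tendsto_const_nhds
        ((hGcont t (hI ht)).comp (hρlim t ht)) (fun _ => zero_le) fun n => ?_
      exact le_iSup₂ (f := fun u (_ : u ∈ J) => edist (G (ρ n t) u) (G t u)) (f t) (hfJ (hI ht))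
  obtain ⟨δ, hδ, hunif⟩ := hGcont.exists_forall_norm_sub_le hI one_pos
  refine LocallyIntegrableOn.integrableOn_isCompact (fun r hr => ?_) isCompact_Icc
  obtain ⟨C, hC⟩ := ae_norm_deriv_smul_comp_le hab hfac hfK (hGloc r (hI hr) c d hKJ)
  refine ⟨Icc a b ∩ Metric.ball r δ,
    inter_mem self_mem_nhdsWithin (mem_nhdsWithin_of_mem_nhds (Metric.ball_mem_nhds r hδ)), ?_⟩
  refine Integrable.mono' (((hdi.mono_set inter_subset_left).abs).const_mul (C + 1))
    (hmeas.mono_set inter_subset_left) ?_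
  rw [ae_restrict_iff' (measurableSet_Icc.inter measurableSet_ball)]
  filter_upwards [hAae, hC] with t hAt hCt ht
  have h1 : A t = deriv f t • G r (f t) + deriv f t • (G t (f t) - G r (f t)) := by
    rw [hAt ht.1, smul_sub]
    abel
  have h2 : ‖deriv f t • (G t (f t) - G r (f t))‖ ≤ |deriv f t| * 1 := by
    rw [norm_smul, Real.norm_eq_abs]
    gcongr
    exact hunif t ht.1 r hr ht.2 _ (hfJ (hI ht.1))
  calc ‖A t‖ ≤ C * |deriv f t| + |deriv f t| * 1 := by
        rw [h1]
        exact (norm_add_le _ _).trans (add_le_add (hCt ht.1) h2)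
    _ = (C + 1) * |deriv f t| := by ring

end LocalIntegrability

/-! ### Evolution operators -/

theorem theorem3p6 {E : Type*} [NormedAddCommGroup E] [NormedSpace ℝ E] [CompleteSpace E]
    (I J : Set ℝ) (hI : I.OrdConnected) (hJ : J.OrdConnected)
    (G : ℝ → ℝ → E →L[ℝ] E)
    (hGloc : ∀ t ∈ I, MemLInftyLoc J (G t))
    (hGint : ∀ t ∈ I, IntegrableOn (G t) J volume)
    (hGcont : SupDistContinuousOn G I J)
    (hGvar : l1Variation G I J < ∞)
    (V N : ℝ)
    (hV : V = (l1Variation G I J).toReal)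
    (hN : N = Real.exp (⨆ t ∈ I, l1Norm J (G t)).toReal)
    (f : ℝ → ℝ) (hf : LocallyAbsolutelyContinuousOn f I) (hfJ : MapsTo f I J)
    (A : ℝ → E →L[ℝ] E) (hA : ∀ t ∈ I, A t = derivWithin f I t • G t (f t)) :
    MemL1Loc I A ∧
      ∀ X : ℝ → ℝ → E →L[ℝ] E, IsEvolutionOperator I A X →
        ∀ s ∈ I, ∀ t ∈ I, s ≤ t →
          ∃ U : (E →L[ℝ] E)ˣ, (U : E →L[ℝ] E) = X t s ∧
            ‖(U : E →L[ℝ] E)‖ ≤ N ^ 2 * Real.exp (N ^ (3 + 2 * N) * V) ∧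
            ‖((U⁻¹ : (E →L[ℝ] E)ˣ) : E →L[ℝ] E)‖ ≤
              N ^ 2 * Real.exp (N ^ (3 + 2 * N) * V) := by
  have hfin := iSup_l1Norm_lt_top hGint hGvar
  have hNle : ∀ t ∈ I, Real.exp (l1Norm J (G t)).toReal ≤ N := fun t ht => by
    rw [hN]
    exact Real.exp_le_exp.2 (ENNReal.toReal_mono hfin.ne
      (le_iSup₂ (f := fun t (_ : t ∈ I) => l1Norm J (G t)) t ht))
  refine ⟨memL1Loc_deriv_smul (F := E →L[ℝ] E) hGloc hGcont hf hfJ hA,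
    fun X hX s hs t ht hst => ?_⟩
  have hsub : Icc s t ⊆ I := hI.out hs ht
  have hN1 : 1 ≤ N := hN ▸ Real.one_le_exp ENNReal.toReal_nonneg
  have hV0 : 0 ≤ V := hV ▸ ENNReal.toReal_nonneg
  have hbound : ∀ x, IsOperatorSolution I A x →
      ‖x t‖ ≤ N ^ 2 * Real.exp (N ^ 2 * V) * ‖x s‖ ∧
      ‖x s‖ ≤ N ^ 2 * Real.exp (N ^ 2 * V) * ‖x t‖ := fun x hx =>
    hx.norm_le_and_norm_le hGloc hGint hGcont hGvar hV hNle hf hfJ hA hst hsub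
  have hle : N ^ 2 * Real.exp (N ^ 2 * V) ≤ N ^ 2 * Real.exp (N ^ (3 + 2 * N) * V) := by
    have : N ^ 2 ≤ N ^ (3 + 2 * N) := by
      rw [← Real.rpow_natCast]
      exact Real.rpow_le_rpow_of_exponent_le hN1 (by push_cast; linarith)
    gcongr
  have hid : ‖ContinuousLinearMap.id ℝ E‖ ≤ 1 := ContinuousLinearMap.norm_id_le
  have hfinal : ∀ {y z : ℝ}, z ≤ 1 → y ≤ N ^ 2 * Real.exp (N ^ 2 * V) * z →
      y ≤ N ^ 2 * Real.exp (N ^ (3 + 2 * N) * V) := fun hz h =>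
    (h.trans (mul_le_of_le_one_right (by positivity) hz)).trans hle
  have hs' := hX.isOperatorSolution s hs
  have ht' := hX.isOperatorSolution t ht
  -- `X · t - X · s * X s t` is a solution that vanishes at `s`, hence at `t`; likewise with `s` and
  -- `t` exchanged
  have hmul₁ : X t s * X s t = 1 := by
    have h := (hbound _ (ht'.sub hI (hs'.mul_const hI (X s t)))).1
    rw [hX.apply_self s hs, hX.apply_self t ht] at h
    have h0 : X s t - ContinuousLinearMap.id ℝ E * X s t = 0 := by
      rw [← ContinuousLinearMap.one_def, one_mul, sub_self]
    rw [h0, norm_zero, mul_zero] at h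
    exact (sub_eq_zero.1 (norm_le_zero_iff.1 h)).symm
  have hmul₂ : X s t * X t s = 1 := by
    have h := (hbound _ (hs'.sub hI (ht'.mul_const hI (X t s)))).2
    rw [hX.apply_self s hs, hX.apply_self t ht] at h
    have h0 : X t s - ContinuousLinearMap.id ℝ E * X t s = 0 := by
      rw [← ContinuousLinearMap.one_def, one_mul, sub_self]
    rw [h0, norm_zero, mul_zero] at h
    exact (sub_eq_zero.1 (norm_le_zero_iff.1 h)).symm
  refine ⟨⟨X t s, X s t, hmul₁, hmul₂⟩, rfl, ?_, ?_⟩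
  · have h := (hbound _ hs').1
    rw [hX.apply_self s hs] at h
    exact hfinal hid h
  · have h := (hbound _ ht').2
    rw [hX.apply_self t ht] at h
    exact hfinal hid h
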